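/- Let $G$ be an essential real reflection group of rank $n$, that is, a finite group of orthogonal transformations of $V=\mathbb{R}^n$ that is generated by reflections and does not fix pointwise any nonzero linear subspace of $V$. Let $\pi_1,\dots,\pi_n\in\mathbb{R}[x_1,\dots,x_n]$ be a set of basic invariants of $G$, that is, algebraically independent homogeneous polynomials that generate the algebra $\mathbb{R}[V]^G$ of $G$-invariant polynomials. Let $f_1,\dots,f_m\in\mathbb{R}[x_1,\dots,x_n]$ be such that the real variety $$X=V_{\mathbb{R}}(f_1,\dots,f_m)=\{p\in\mathbb{R}^n : f_1(p)=\dots=f_m(p)=0\}$$ is nonempty. If there is an index $j\in\{1,\dots,n\}$ such that $f_1,\dots,f_m\in\mathbb{R}[\pi_i : i\neq j]$, then $X\cap\mathcal{H}_{n-1}(G)\neq\emptyset$. Here $\mathcal{H}_{i}(G)$ denotes the set of points of $V$ that lie in an $i$-dimensional flat, a flat being an intersection of reflection hyperplanes of $G$ (the fixed hyperplanes of the reflections in $G$); so $\mathcal{H}_{n-1}(G)$ is the union of the reflection hyperplanes of $G$. -/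

import Mathlib

namespace ReflectionGroups

noncomputable section

/-- An orthogonal transformation of `ℝⁿ` is a reflection if it is the orthogonal reflection in
the hyperplane orthogonal to some nonzero vector. -/
def IsReflection {n : ℕ} (g : EuclideanSpace ℝ (Fin n) ≃ₗᵢ[ℝ] EuclideanSpace ℝ (Fin n)) : Prop :=
  ∃ v : EuclideanSpace ℝ (Fin n), v ≠ 0 ∧ g = (ℝ ∙ v)ᗮ.reflection

/-- A reflection group: a finite group of orthogonal transformations generated by reflections. -/
structure IsReflectionGroup {n : ℕ}
    (G : Subgroup (EuclideanSpace ℝ (Fin n) ≃ₗᵢ[ℝ] EuclideanSpace ℝ (Fin n))) : Prop where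
  finite : Finite G
  generated : Subgroup.closure {g | g ∈ G ∧ IsReflection g} = G

/-- `G` is essential if it fixes (pointwise) no nontrivial linear subspace. -/
def IsEssential {n : ℕ}
    (G : Subgroup (EuclideanSpace ℝ (Fin n) ≃ₗᵢ[ℝ] EuclideanSpace ℝ (Fin n))) : Prop :=
  ∀ W : Submodule ℝ (EuclideanSpace ℝ (Fin n)), (∀ g ∈ G, ∀ w ∈ W, g w = w) → W = ⊥

/-- The hyperplane of fixed points of `g`, for each reflection `g ∈ G`. -/
def arrangement {n : ℕ}
    (G : Subgroup (EuclideanSpace ℝ (Fin n) ≃ₗᵢ[ℝ] EuclideanSpace ℝ (Fin n))) :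
    Set (Submodule ℝ (EuclideanSpace ℝ (Fin n))) :=
  {H | ∃ g ∈ G, IsReflection g ∧
    H = LinearMap.ker (g.toLinearEquiv.toLinearMap - LinearMap.id)}

/-- The flats are the intersections of hyperplanes of the arrangement; the empty intersection is
the whole space. -/
def IsFlat {n : ℕ}
    (G : Subgroup (EuclideanSpace ℝ (Fin n) ≃ₗᵢ[ℝ] EuclideanSpace ℝ (Fin n)))
    (F : Submodule ℝ (EuclideanSpace ℝ (Fin n))) : Prop :=
  ∃ S : Set (Submodule ℝ (EuclideanSpace ℝ (Fin n))), S ⊆ arrangement G ∧ F = sInf S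

/-- The stratum `H_i(G)`: the points that are contained in a flat of dimension `i`. -/
def stratum {n : ℕ}
    (G : Subgroup (EuclideanSpace ℝ (Fin n) ≃ₗᵢ[ℝ] EuclideanSpace ℝ (Fin n))) (i : ℕ) :
    Set (EuclideanSpace ℝ (Fin n)) :=
  {p | ∃ F : Submodule ℝ (EuclideanSpace ℝ (Fin n)),
    IsFlat G F ∧ Module.finrank ℝ F = i ∧ p ∈ F}

/-- The value of a real polynomial at a point of `ℝⁿ`. -/
def evalAt {n : ℕ} (p : EuclideanSpace ℝ (Fin n)) (f : MvPolynomial (Fin n) ℝ) : ℝ :=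
  MvPolynomial.eval (fun i => p i) f

/-- The ring `ℝ[V]^G` of polynomials with `f (g⁻¹ x) = f x` for all `g ∈ G`. Over `ℝ`, equality of
polynomials is the same as equality of their values at all points. -/
def invariants {n : ℕ}
    (G : Subgroup (EuclideanSpace ℝ (Fin n) ≃ₗᵢ[ℝ] EuclideanSpace ℝ (Fin n))) :
    Subalgebra ℝ (MvPolynomial (Fin n) ℝ) where
  carrier := {f | ∀ g ∈ G, ∀ x : EuclideanSpace ℝ (Fin n), evalAt (g⁻¹ x) f = evalAt x f}
  mul_mem' := by
    intro a b ha hb g hg x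
    have h1 := ha g hg x
    have h2 := hb g hg x
    simp only [evalAt, map_mul] at *
    rw [h1, h2]
  add_mem' := by
    intro a b ha hb g hg x
    have h1 := ha g hg x
    have h2 := hb g hg x
    simp only [evalAt, map_add] at *
    rw [h1, h2]
  algebraMap_mem' := by
    intro r g _ x
    simp [evalAt, MvPolynomial.algebraMap_eq]

/-- A set of basic invariants of `G`: algebraically independent homogeneous polynomials
`π₁, …, πₙ` that generate `ℝ[V]^G` as an `ℝ`-algebra. -/
structure IsBasicInvariants {n : ℕ}
    (G : Subgroup (EuclideanSpace ℝ (Fin n) ≃ₗᵢ[ℝ] EuclideanSpace ℝ (Fin n)))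
    (π : Fin n → MvPolynomial (Fin n) ℝ) : Prop where
  algebraicIndependent : AlgebraicIndependent ℝ π
  homogeneous : ∀ i, ∃ d : ℕ, (π i).IsHomogeneous d
  generate : Algebra.adjoin ℝ (Set.range π) = invariants G

/-- The real variety `V_ℝ(f₁, …, fₘ)`. -/
def realVariety {n m : ℕ} (f : Fin m → MvPolynomial (Fin n) ℝ) :
    Set (EuclideanSpace ℝ (Fin n)) :=
  {p | ∀ k, evalAt p (f k) = 0}

end

end ReflectionGroups

/-!
On a fibre of the basic invariants `π i`, `i ≠ j`, the remaining invariant `π j` attains an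
extremum: since `G` is essential, no `π i` is linear, so the invariant quadratic form `‖x‖ ^ 2` is a
linear combination of the `π i`; hence either the fibre is bounded, or its point closest to the
origin is an extremum of `π j`. By Lagrange multipliers the differentials of all the `π i` are
linearly dependent at this point. But at a point that lies on no mirror they are independent: such
a point has trivial stabilizer, so some polynomial has a prescribed nonzero differential there and
vanishing differential along the rest of the orbit, and by averaging over `G` invariant
polynomials separate tangent directions.
-/

namespace ReflectionGroups

open scoped RealInnerProductSpace
open MvPolynomial (homogeneousComponent homogeneousComponent_of_mem)

section RegularPoints

variable {E : Type*} [NormedAddCommGroup E] [InnerProductSpace ℝ E]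

/-- The orthogonal reflection in the hyperplane orthogonal to `α`; it is the identity for
`α = 0`. -/
noncomputable abbrev rootReflection (α : E) : E ≃ₗᵢ[ℝ] E := (ℝ ∙ α)ᗮ.reflection

lemma rootReflection_apply {α : E} (hα : ‖α‖ = 1) (x : E) :
    rootReflection α x = x - (2 * ⟪α, x⟫) • α := by
  rw [Submodule.reflection_orthogonal_apply, Submodule.reflection_singleton_apply]
  simp [hα, two_smul, two_mul, add_smul]

lemma rootReflection_smul {r : ℝ} (hr : r ≠ 0) (α : E) :
    rootReflection (r • α) = rootReflection α := by
  simp only [rootReflection, Submodule.span_singleton_smul_eq (IsUnit.mk0 r hr)]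

lemma rootReflection_neg (α : E) : rootReflection (-α) = rootReflection α := by
  rw [← neg_one_smul ℝ α, rootReflection_smul (by norm_num)]

lemma rootReflection_map (w : E ≃ₗᵢ[ℝ] E) {α : E} (hα : ‖α‖ = 1) :
    rootReflection (w α) = w * rootReflection α * w⁻¹ := by
  ext x
  obtain ⟨y, rfl⟩ := w.surjective x
  have hwy : w⁻¹ (w y) = y := w.symm_apply_apply y
  simp only [LinearIsometryEquiv.coe_mul, Function.comp_apply, hwy, rootReflection_apply hα,
    rootReflection_apply ((w.norm_map α).trans hα), map_sub, map_smul, w.inner_map_map]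

/-- The roots of `G`: the unit normals of the mirrors of the reflections in `G`. -/
def roots (G : Subgroup (E ≃ₗᵢ[ℝ] E)) : Set E :=
  {α | ‖α‖ = 1 ∧ rootReflection α ∈ G}

variable {G : Subgroup (E ≃ₗᵢ[ℝ] E)} {p α β : E}

lemma neg_mem_roots (hα : α ∈ roots G) : -α ∈ roots G :=
  ⟨(norm_neg α).trans hα.1, (rootReflection_neg α).symm ▸ hα.2⟩

lemma map_mem_roots {w : E ≃ₗᵢ[ℝ] E} (hw : w ∈ G) (hα : α ∈ roots G) : w α ∈ roots G :=
  ⟨(w.norm_map α).trans hα.1,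
    rootReflection_map w hα.1 ▸ G.mul_mem (G.mul_mem hw hα.2) (G.inv_mem hw)⟩

/-- A point is regular for `G` if it lies on no mirror of a reflection in `G`. -/
def IsRegular (G : Subgroup (E ≃ₗᵢ[ℝ] E)) (p : E) : Prop :=
  ∀ α ∈ roots G, ⟪α, p⟫ ≠ 0

/-- The roots of `G` on the same side of their mirrors as `p`. -/
def posRoots (G : Subgroup (E ≃ₗᵢ[ℝ] E)) (p : E) : Set E :=
  {α | α ∈ roots G ∧ 0 < ⟪α, p⟫}

lemma IsRegular.mem_posRoots_or_neg_mem (hp : IsRegular G p) (hα : α ∈ roots G) :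
    α ∈ posRoots G p ∨ -α ∈ posRoots G p :=
  (hp α hα).lt_or_gt.symm.imp (fun h => ⟨hα, h⟩)
    fun h => ⟨neg_mem_roots hα, by rwa [inner_neg_left, neg_pos]⟩

lemma rootReflection_injOn_posRoots : Set.InjOn rootReflection (posRoots G p) := by
  rintro α ⟨⟨hα, -⟩, hαp⟩ β ⟨⟨hβ, -⟩, hβp⟩ h
  have hsmul : (2 * ⟪α, p⟫) • α = (2 * ⟪β, p⟫) • β := by
    simpa [rootReflection_apply hα, rootReflection_apply hβ] using DFunLike.congr_fun h p
  have hinner : 2 * ⟪α, p⟫ = 2 * ⟪β, p⟫ := by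
    simpa [norm_smul, hα, hβ, abs_of_pos hαp, abs_of_pos hβp] using congrArg norm hsmul
  rw [← hinner] at hsmul
  exact smul_right_injective E (by positivity) hsmul

lemma finite_posRoots [Finite G] : (posRoots G p).Finite :=
  Set.Finite.of_injOn (fun _ hα => hα.1.2) rootReflection_injOn_posRoots
    (G : Set (E ≃ₗᵢ[ℝ] E)).toFinite

/-- A positive root is simple if its reflection keeps all other positive roots positive, that is,
if its mirror is the only one that separates `p` from its reflected image. -/
def IsSimpleRoot (G : Subgroup (E ≃ₗᵢ[ℝ] E)) (p α : E) : Prop :=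
  α ∈ posRoots G p ∧ ∀ β ∈ posRoots G p, β ≠ α → rootReflection α β ∈ posRoots G p

lemma inner_lt_one_of_mem_roots (hα : α ∈ roots G) (hβ : β ∈ roots G) (h : α ≠ β) : ⟪α, β⟫ < 1 :=
  (inner_lt_one_iff_real_of_norm_eq_one hα.1 hβ.1).2 h

lemma IsRegular.exists_lower_posRoot (hp : IsRegular G p) {γ : E} (hγ : γ ∈ posRoots G p)
    (hγs : ¬ IsSimpleRoot G p γ) :
    ∃ β ∈ posRoots G p, 0 < ⟪β, γ⟫ ∧ ⟪β, p⟫ < ⟪γ, p⟫ := by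
  -- `γ` is a positive multiple of `β + β'`, where `β` and `β' = -s_γ β` are both positive, so one
  -- of the two has smaller inner product with `p` than `γ`.
  simp only [IsSimpleRoot, hγ, true_and, not_forall] at hγs
  obtain ⟨β, hβ, hne, hβγ⟩ := hγs
  have hβ' : -rootReflection γ β ∈ posRoots G p :=
    (hp.mem_posRoots_or_neg_mem (map_mem_roots hγ.1.2 hβ.1)).resolve_left hβγ
  have hlt := inner_lt_one_of_mem_roots hβ.1 hγ.1 hne
  have hγp := hγ.2
  have hγγ : ⟪γ, γ⟫ = 1 := by rw [real_inner_self_eq_norm_sq, hγ.1.1, one_pow]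
  have hsum : ⟪-rootReflection γ β, p⟫ = 2 * ⟪β, γ⟫ * ⟪γ, p⟫ - ⟪β, p⟫ := by
    rw [rootReflection_apply hγ.1.1, neg_sub, inner_sub_left, real_inner_smul_left,
      real_inner_comm γ β]
  have hinner : ⟪-rootReflection γ β, γ⟫ = ⟪β, γ⟫ := by
    rw [rootReflection_apply hγ.1.1, neg_sub, inner_sub_left, real_inner_smul_left, hγγ,
      real_inner_comm γ β]
    ring
  have hβ'p := hβ'.2
  have hβp := hβ.2
  have hpos : 0 < ⟪β, γ⟫ := by
    rw [hsum] at hβ'p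
    exact pos_of_mul_pos_left (by linarith : 0 < ⟪β, γ⟫ * ⟪γ, p⟫) hγp.le
  rcases lt_or_ge ⟪β, p⟫ ⟪γ, p⟫ with h | h
  · exact ⟨β, hβ, hpos, h⟩
  · exact ⟨_, hβ', hinner ▸ hpos, by rw [hsum]; nlinarith⟩

lemma IsRegular.rootReflection_mem_closure_of_mem_posRoots [Finite G] (hp : IsRegular G p)
    {γ : E} (hγ : γ ∈ posRoots G p) :
    rootReflection γ ∈ Subgroup.closure (rootReflection '' {α | IsSimpleRoot G p α}) := by
  set K := Subgroup.closure (rootReflection '' {α | IsSimpleRoot G p α})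
  by_contra hγK
  obtain ⟨γ, ⟨hγ, hγK⟩, hmin⟩ := Set.exists_min_image
    {γ | γ ∈ posRoots G p ∧ rootReflection γ ∉ K} (fun γ => ⟪γ, p⟫)
    (finite_posRoots.subset fun _ h => h.1) ⟨γ, hγ, hγK⟩
  have hlower : ∀ δ ∈ posRoots G p, ⟪δ, p⟫ < ⟪γ, p⟫ → rootReflection δ ∈ K := fun δ hδ hlt => by
    by_contra hδK
    exact (hmin δ ⟨hδ, hδK⟩).not_gt hlt
  obtain ⟨β, hβ, hβγ, hlt⟩ := hp.exists_lower_posRoot hγ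
    fun h => hγK (Subgroup.subset_closure (Set.mem_image_of_mem _ h))
  have hβK := hlower β hβ hlt
  have hδp : ⟪rootReflection β γ, p⟫ = ⟪γ, p⟫ - 2 * ⟪β, γ⟫ * ⟪β, p⟫ := by
    rw [rootReflection_apply hβ.1.1, inner_sub_left, real_inner_smul_left]
  have hδK : rootReflection (rootReflection β γ) ∈ K := by
    have hmul : 0 < ⟪β, γ⟫ * ⟪β, p⟫ := mul_pos hβγ hβ.2
    rcases hp.mem_posRoots_or_neg_mem (map_mem_roots hβ.1.2 hγ.1) with hδ | hδ
    · exact hlower _ hδ (by linarith)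
    · rw [← rootReflection_neg]
      have hne : β ≠ γ := fun h => hlt.ne (by rw [h])
      have hlt_one := inner_lt_one_of_mem_roots hβ.1 hγ.1 hne
      refine hlower _ hδ ?_
      rw [inner_neg_left, hδp]
      nlinarith [hβ.2]
  rw [rootReflection_map _ hγ.1.1] at hδK
  exact hγK ((K.mul_mem_cancel_left hβK).1 ((K.mul_mem_cancel_right (K.inv_mem hβK)).1 hδK))

lemma norm_inv_smul_mem_roots {v : E} (hv : v ≠ 0) (hG : rootReflection v ∈ G) :
    ‖v‖⁻¹ • v ∈ roots G :=
  ⟨norm_smul_inv_norm hv, by rwa [rootReflection_smul (inv_ne_zero (norm_ne_zero_iff.2 hv))]⟩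

lemma IsRegular.rootReflection_mem_closure [Finite G] (hp : IsRegular G p) {v : E} (hv : v ≠ 0)
    (hG : rootReflection v ∈ G) :
    rootReflection v ∈ Subgroup.closure (rootReflection '' {α | IsSimpleRoot G p α}) := by
  rw [← rootReflection_smul (inv_ne_zero (norm_ne_zero_iff.2 hv)) v]
  rcases hp.mem_posRoots_or_neg_mem (norm_inv_smul_mem_roots hv hG) with h | h
  · exact hp.rootReflection_mem_closure_of_mem_posRoots h
  · exact rootReflection_neg (‖v‖⁻¹ • v) ▸ hp.rootReflection_mem_closure_of_mem_posRoots h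

/-- A word in the simple roots stands for the product of the corresponding reflections. -/
noncomputable def wordProd (l : List E) : E ≃ₗᵢ[ℝ] E := (l.map rootReflection).prod

lemma wordProd_cons (α : E) (l : List E) : wordProd (α :: l) = rootReflection α * wordProd l := by
  simp only [wordProd, List.map_cons, List.prod_cons]

lemma wordProd_concat (l : List E) (α : E) :
    wordProd (l ++ [α]) = wordProd l * rootReflection α := by
  simp [wordProd]

lemma exists_wordProd_eq {g : E ≃ₗᵢ[ℝ] E}
    (hg : g ∈ Subgroup.closure (rootReflection '' {α | IsSimpleRoot G p α})) :
    ∃ l : List E, (∀ α ∈ l, IsSimpleRoot G p α) ∧ wordProd l = g := by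
  induction hg using Subgroup.closure_induction_left with
  | one => exact ⟨[], by simp, rfl⟩
  | mul_left _ hα _ _ ih =>
    obtain ⟨⟨α, hα, rfl⟩, l, hl, rfl⟩ := hα, ih
    exact ⟨α :: l, List.forall_mem_cons.2 ⟨hα, hl⟩, wordProd_cons α l⟩
  | inv_mul_cancel _ hα _ _ ih =>
    obtain ⟨⟨α, hα, rfl⟩, l, hl, rfl⟩ := hα, ih
    exact ⟨α :: l, List.forall_mem_cons.2 ⟨hα, hl⟩,
      by rw [wordProd_cons, Submodule.reflection_inv]⟩

lemma IsSimpleRoot.exists_wordProd_eq_mul_rootReflection (hβ : IsSimpleRoot G p β) {l : List E}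
    (hl : ∀ α ∈ l, IsSimpleRoot G p α)
    (h : wordProd l β ∉ posRoots G p) :
    ∃ l' : List E, (∀ α ∈ l', IsSimpleRoot G p α) ∧ l'.length < l.length ∧
      wordProd l' = wordProd l * rootReflection β := by
  induction l with
  | nil => exact absurd hβ.1 h
  | cons α l ih =>
    obtain ⟨hα, hl⟩ := List.forall_mem_cons.1 hl
    rw [wordProd_cons] at h ⊢
    by_cases hlβ : wordProd l β ∈ posRoots G p
    · have heq : wordProd l β = α := by
        by_contra hne
        exact h (hα.2 _ hlβ hne)
      refine ⟨l, hl, by simp, ?_⟩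
      rw [← heq, rootReflection_map _ hβ.1.1.1, inv_mul_cancel_right, mul_assoc,
        Submodule.reflection_mul_reflection, mul_one]
    · obtain ⟨l', hl', hlt, heq⟩ := ih hl hlβ
      exact ⟨α :: l', List.forall_mem_cons.2 ⟨hα, hl'⟩, by simpa using hlt,
        by rw [wordProd_cons, heq, mul_assoc]⟩

lemma wordProd_eq_one {l : List E} (hl : ∀ α ∈ l, IsSimpleRoot G p α)
    (hlp : wordProd l p = p) : wordProd l = 1 := by
  induction hk : l.length using Nat.strong_induction_on generalizing l with
  | _ k ih =>
    rcases List.eq_nil_or_concat' l with rfl | ⟨l, β, rfl⟩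
    · rfl
    obtain ⟨hl, hβ⟩ := List.forall_mem_append.1 hl
    replace hβ : IsSimpleRoot G p β := hβ β (List.mem_singleton_self β)
    have hneg : wordProd l β ∉ posRoots G p := fun h => by
      have hinner : -⟪wordProd l β, p⟫ = ⟪β, p⟫ := calc
        -⟪wordProd l β, p⟫ = ⟪wordProd (l ++ [β]) β, wordProd (l ++ [β]) p⟫ := by
          rw [hlp, wordProd_concat, LinearIsometryEquiv.coe_mul, Function.comp_apply,
            Submodule.reflection_orthogonalComplement_singleton_eq_neg, map_neg, inner_neg_left]
        _ = ⟪β, p⟫ := (wordProd (l ++ [β])).inner_map_map β p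
      linarith [h.2, hβ.1.2]
    obtain ⟨l', hl', hlt, heq⟩ := hβ.exists_wordProd_eq_mul_rootReflection hl hneg
    rw [wordProd_concat, ← heq] at hlp ⊢
    exact ih l'.length (by simp at hk; omega) hl' hlp rfl

lemma IsRegular.eq_one_of_apply_eq_self [Finite G] (hp : IsRegular G p)
    (hgen : G ≤ Subgroup.closure {g | g ∈ G ∧ ∃ v : E, v ≠ 0 ∧ g = rootReflection v})
    {g : E ≃ₗᵢ[ℝ] E} (hg : g ∈ G) (hgp : g p = p) : g = 1 := by
  have hle : Subgroup.closure {g | g ∈ G ∧ ∃ v : E, v ≠ 0 ∧ g = rootReflection v} ≤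
      Subgroup.closure (rootReflection '' {α | IsSimpleRoot G p α}) := by
    rw [Subgroup.closure_le]
    rintro _ ⟨hG, v, hv, rfl⟩
    exact hp.rootReflection_mem_closure hv hG
  obtain ⟨l, hl, rfl⟩ := exists_wordProd_eq (hle (hgen hg))
  exact wordProd_eq_one hl hgp

end RegularPoints

section Differentials

variable {n : ℕ} {G : Subgroup (EuclideanSpace ℝ (Fin n) ≃ₗᵢ[ℝ] EuclideanSpace ℝ (Fin n))}

lemma evalAt_add (x : EuclideanSpace ℝ (Fin n)) (f g : MvPolynomial (Fin n) ℝ) :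
    evalAt x (f + g) = evalAt x f + evalAt x g := map_add _ _ _

lemma evalAt_mul (x : EuclideanSpace ℝ (Fin n)) (f g : MvPolynomial (Fin n) ℝ) :
    evalAt x (f * g) = evalAt x f * evalAt x g := map_mul _ _ _

lemma evalAt_sum {ι : Type*} (x : EuclideanSpace ℝ (Fin n)) (s : Finset ι)
    (f : ι → MvPolynomial (Fin n) ℝ) : evalAt x (∑ i ∈ s, f i) = ∑ i ∈ s, evalAt x (f i) :=
  map_sum _ _ _

lemma evalAt_prod {ι : Type*} (x : EuclideanSpace ℝ (Fin n)) (s : Finset ι)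
    (f : ι → MvPolynomial (Fin n) ℝ) : evalAt x (∏ i ∈ s, f i) = ∏ i ∈ s, evalAt x (f i) :=
  map_prod _ _ _

lemma evalAt_algebraMap (x : EuclideanSpace ℝ (Fin n)) (r : ℝ) :
    evalAt x (algebraMap ℝ (MvPolynomial (Fin n) ℝ) r) = r :=
  MvPolynomial.eval_C r

lemma evalAt_eq_of_mem_adjoin {s : Set (MvPolynomial (Fin n) ℝ)} {x y : EuclideanSpace ℝ (Fin n)}
    (h : ∀ f ∈ s, evalAt x f = evalAt y f) {f : MvPolynomial (Fin n) ℝ}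
    (hf : f ∈ Algebra.adjoin ℝ s) : evalAt x f = evalAt y f :=
  AlgHom.eqOn_adjoin_iff (φ := MvPolynomial.aeval fun i => x i)
    (ψ := MvPolynomial.aeval fun i => y i) |>.2 h hf

lemma contDiff_evalAt (f : MvPolynomial (Fin n) ℝ) :
    ContDiff ℝ 1 fun x : EuclideanSpace ℝ (Fin n) => evalAt x f :=
  (AnalyticOnNhd.eval_continuousLinearMap'
    (fun i => (EuclideanSpace.proj i : EuclideanSpace ℝ (Fin n) →L[ℝ] ℝ)) f).contDiff

lemma continuous_evalAt (f : MvPolynomial (Fin n) ℝ) :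
    Continuous fun x : EuclideanSpace ℝ (Fin n) => evalAt x f :=
  (contDiff_evalAt f).continuous

/-- The differential at `p` of the function on `ℝⁿ` given by the polynomial `f`. -/
noncomputable def differential (f : MvPolynomial (Fin n) ℝ) (p : EuclideanSpace ℝ (Fin n)) :
    StrongDual ℝ (EuclideanSpace ℝ (Fin n)) :=
  fderiv ℝ (fun x => evalAt x f) p

lemma hasStrictFDerivAt_evalAt (f : MvPolynomial (Fin n) ℝ) (p : EuclideanSpace ℝ (Fin n)) :
    HasStrictFDerivAt (fun x => evalAt x f) (differential f p) p :=
  (contDiff_evalAt f).contDiffAt.hasStrictFDerivAt one_ne_zero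

lemma hasFDerivAt_evalAt (f : MvPolynomial (Fin n) ℝ) (p : EuclideanSpace ℝ (Fin n)) :
    HasFDerivAt (fun x => evalAt x f) (differential f p) p :=
  (hasStrictFDerivAt_evalAt f p).hasFDerivAt

lemma differential_algebraMap (r : ℝ) (p : EuclideanSpace ℝ (Fin n)) :
    differential (algebraMap ℝ (MvPolynomial (Fin n) ℝ) r) p = 0 := by
  simp only [differential, evalAt_algebraMap, fderiv_fun_const, Pi.zero_apply]

lemma differential_add (f g : MvPolynomial (Fin n) ℝ) (p : EuclideanSpace ℝ (Fin n)) :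
    differential (f + g) p = differential f p + differential g p := by
  simpa only [differential, evalAt_add] using
    ((hasFDerivAt_evalAt f p).fun_add (hasFDerivAt_evalAt g p)).fderiv

lemma differential_sum {ι : Type*} (s : Finset ι) (f : ι → MvPolynomial (Fin n) ℝ)
    (p : EuclideanSpace ℝ (Fin n)) :
    differential (∑ i ∈ s, f i) p = ∑ i ∈ s, differential (f i) p := by
  simpa only [differential, evalAt_sum] using
    (HasFDerivAt.fun_sum fun i (_ : i ∈ s) => hasFDerivAt_evalAt (f i) p).fderiv

lemma differential_mul (f g : MvPolynomial (Fin n) ℝ) (p : EuclideanSpace ℝ (Fin n)) :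
    differential (f * g) p = evalAt p f • differential g p + evalAt p g • differential f p := by
  simpa only [differential, evalAt_mul] using
    ((hasFDerivAt_evalAt f p).fun_mul (hasFDerivAt_evalAt g p)).fderiv

lemma differential_apply_eq_zero_of_mem_adjoin {s : Set (MvPolynomial (Fin n) ℝ)}
    {p v : EuclideanSpace ℝ (Fin n)} (h : ∀ f ∈ s, differential f p v = 0)
    {f : MvPolynomial (Fin n) ℝ} (hf : f ∈ Algebra.adjoin ℝ s) : differential f p v = 0 := by
  induction hf using Algebra.adjoin_induction with
  | mem f hf => exact h f hf
  | algebraMap r => rw [differential_algebraMap, zero_apply]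
  | add f g _ _ hf hg => simp [differential_add, hf, hg]
  | mul f g _ _ hf hg => simp [differential_mul, hf, hg]

/-- The polynomial whose value at `x` is the squared distance from `x` to `y`. -/
noncomputable def sqDistPoly (y : EuclideanSpace ℝ (Fin n)) : MvPolynomial (Fin n) ℝ :=
  ∑ i, (MvPolynomial.X i - MvPolynomial.C (y i)) ^ 2

lemma evalAt_sqDistPoly (y x : EuclideanSpace ℝ (Fin n)) :
    evalAt x (sqDistPoly y) = ‖x - y‖ ^ 2 := by
  simp [evalAt, sqDistPoly, EuclideanSpace.norm_sq_eq]

lemma differential_sqDistPoly_self (y : EuclideanSpace ℝ (Fin n)) :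
    differential (sqDistPoly y) y = 0 := by
  simpa [differential, evalAt_sqDistPoly] using ((hasFDerivAt_id y).sub_const y).norm_sq.fderiv

/-- The linear polynomial whose value at `x` is the inner product of `v` and `x`. -/
noncomputable def innerPoly (v : EuclideanSpace ℝ (Fin n)) : MvPolynomial (Fin n) ℝ :=
  ∑ i, v i • MvPolynomial.X i

lemma evalAt_innerPoly (v x : EuclideanSpace ℝ (Fin n)) : evalAt x (innerPoly v) = ⟪v, x⟫ := by
  simp [evalAt, innerPoly, PiLp.inner_apply, mul_comm]

lemma differential_innerPoly (v p : EuclideanSpace ℝ (Fin n)) :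
    differential (innerPoly v) p = innerSL ℝ v := by
  simp only [differential, evalAt_innerPoly]
  exact (innerSL ℝ v).fderiv

lemma exists_differential_eq_zero_and_apply_ne_zero (s : Finset (EuclideanSpace ℝ (Fin n)))
    {p v : EuclideanSpace ℝ (Fin n)} (hp : p ∉ s) (hv : v ≠ 0) :
    ∃ q : MvPolynomial (Fin n) ℝ, (∀ y ∈ s, differential q y = 0) ∧ differential q p v ≠ 0 := by
  classical
  set m : MvPolynomial (Fin n) ℝ := ∏ y ∈ s, sqDistPoly y
  set l : MvPolynomial (Fin n) ℝ := innerPoly v + algebraMap ℝ _ (-⟪v, p⟫)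
  have hlp : evalAt p l = 0 := by
    rw [evalAt_add, evalAt_innerPoly, evalAt_algebraMap, add_neg_cancel]
  have hlv : differential l p v = ‖v‖ ^ 2 := by
    simp only [l, differential_add, differential_innerPoly, differential_algebraMap, add_zero,
      innerSL_apply_apply, real_inner_self_eq_norm_sq]
  have hmp : evalAt p m ≠ 0 := by
    simp only [m, evalAt_prod, evalAt_sqDistPoly]
    exact Finset.prod_ne_zero_iff.2 fun y hy =>
      pow_ne_zero 2 (norm_ne_zero_iff.2 (sub_ne_zero.2 fun h => hp (h ▸ hy)))
  refine ⟨l * m, fun y hy => ?_, ?_⟩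
  · have hlm : l * m = sqDistPoly y * (l * ∏ z ∈ s.erase y, sqDistPoly z) := by
      rw [mul_left_comm, Finset.mul_prod_erase s sqDistPoly hy]
    simp [hlm, differential_mul, differential_sqDistPoly_self, evalAt_sqDistPoly]
  · rw [differential_mul, hlp, zero_smul, zero_add, smul_apply, hlv]
    exact mul_ne_zero hmp (pow_ne_zero 2 (norm_ne_zero_iff.2 hv))

/-- The composition of the polynomial function `f` with a linear map, as a polynomial; the `i`-th
coordinate of `L x` is the value at `x` of a linear polynomial. -/
noncomputable def pullback (L : EuclideanSpace ℝ (Fin n) →L[ℝ] EuclideanSpace ℝ (Fin n))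
    (f : MvPolynomial (Fin n) ℝ) : MvPolynomial (Fin n) ℝ :=
  MvPolynomial.bind₁ (fun i => innerPoly (L.adjoint (EuclideanSpace.single i 1))) f

lemma evalAt_pullback (L : EuclideanSpace ℝ (Fin n) →L[ℝ] EuclideanSpace ℝ (Fin n))
    (f : MvPolynomial (Fin n) ℝ) (x : EuclideanSpace ℝ (Fin n)) :
    evalAt x (pullback L f) = evalAt (L x) f := by
  have hcoord : ∀ i, evalAt x (innerPoly (L.adjoint (EuclideanSpace.single i 1))) = L x i :=
    fun i => by simp [evalAt_innerPoly, ContinuousLinearMap.adjoint_inner_left,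
      EuclideanSpace.inner_single_left]
  simp only [evalAt] at hcoord ⊢
  simp only [pullback, ← hcoord]
  exact MvPolynomial.eval₂Hom_bind₁ ..

lemma differential_pullback_apply
    (L : EuclideanSpace ℝ (Fin n) →L[ℝ] EuclideanSpace ℝ (Fin n)) (f : MvPolynomial (Fin n) ℝ)
    (p v : EuclideanSpace ℝ (Fin n)) :
    differential (pullback L f) p v = differential f (L p) (L v) := by
  have h := (hasFDerivAt_evalAt f (L p)).comp p L.hasFDerivAt
  simp only [differential, evalAt_pullback]
  exact DFunLike.congr_fun h.fderiv v

lemma sum_pullback_mem_invariants [Fintype G] (q : MvPolynomial (Fin n) ℝ) :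
    ∑ g : G, pullback g.1 q ∈ invariants G := by
  intro g hg x
  rw [evalAt_sum, evalAt_sum]
  simp only [evalAt_pullback]
  exact Fintype.sum_equiv (Equiv.mulRight (⟨g, hg⟩ : G)⁻¹) _ _ fun h => rfl

lemma exists_mem_invariants_differential_apply_ne_zero [Finite G] {p v : EuclideanSpace ℝ (Fin n)}
    (hp : ∀ g ∈ G, g p = p → g = 1) (hv : v ≠ 0) :
    ∃ F ∈ invariants G, differential F p v ≠ 0 := by
  classical
  have : Fintype G := Fintype.ofFinite G
  obtain ⟨q, hq, hqv⟩ := exists_differential_eq_zero_and_apply_ne_zero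
    ((Finset.univ.image fun g : G => g.1 p).erase p) (Finset.notMem_erase p _) hv
  refine ⟨_, sum_pullback_mem_invariants q, ?_⟩
  rw [differential_sum, sum_apply, Finset.sum_eq_single (1 : G) _ (by simp),
    differential_pullback_apply]
  · exact hqv
  · intro g _ hg
    have hgp : g.1 p ≠ p := fun h => hg (Subtype.ext (hp g g.2 h))
    have hmem : g.1 p ∈ (Finset.univ.image fun g : G => g.1 p).erase p :=
      Finset.mem_erase.2 ⟨hgp, Finset.mem_image_of_mem _ (Finset.mem_univ g)⟩
    rw [differential_pullback_apply]
    exact DFunLike.congr_fun (hq _ hmem) (g.1 v)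

lemma linearIndependent_differential [Finite G] {π : Fin n → MvPolynomial (Fin n) ℝ}
    (hπ : Algebra.adjoin ℝ (Set.range π) = invariants G) {p : EuclideanSpace ℝ (Fin n)}
    (hp : ∀ g ∈ G, g p = p → g = 1) : LinearIndependent ℝ fun i => differential (π i) p := by
  have h : LinearIndependent ℝ fun i => (differential (π i) p).toLinearMap := by
    refine linearIndependent_of_top_le_span_of_card_eq_finrank
      (Submodule.span_eq_top_of_ne_zero fun v hv => ?_).ge (by simp [Subspace.dual_finrank_eq])
    by_contra! hzero
    obtain ⟨F, hF, hFv⟩ := exists_mem_invariants_differential_apply_ne_zero hp hv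
    have hπv : ∀ i, differential (π i) p v = 0 := fun i => hzero _ (Set.mem_range_self i)
    exact hFv (differential_apply_eq_zero_of_mem_adjoin (Set.forall_mem_range.2 hπv) (hπ ▸ hF))
  exact h.of_comp (ContinuousLinearMap.coeLM ℝ)

end Differentials

section QuadraticPart

variable {σ R : Type*} [CommSemiring R]

lemma homogeneousComponent_mul (k : ℕ) (f g : MvPolynomial σ R) :
    homogeneousComponent k (f * g) = ∑ ij ∈ Finset.HasAntidiagonal.antidiagonal k,
      homogeneousComponent ij.1 f * homogeneousComponent ij.2 g := by
  let := MvPolynomial.gradedAlgebra (σ := σ) (R := R)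
  have hcoe : ∀ (f : MvPolynomial σ R) i,
      (DirectSum.decompose (MvPolynomial.homogeneousSubmodule σ R) f i : MvPolynomial σ R) =
        homogeneousComponent i f := MvPolynomial.decomposition.decompose'_apply
  rw [← hcoe, DirectSum.decompose_mul, DirectSum.coe_mul_apply_eq_sum_antidiagonal]
  simp only [hcoe]

lemma homogeneousComponent_one_eq_zero_and_two_mem_span {s : Set (MvPolynomial σ R)}
    (hs : ∀ f ∈ s, ∃ d ≠ 1, f.IsHomogeneous d) {f : MvPolynomial σ R}
    (hf : f ∈ Algebra.adjoin R s) :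
    homogeneousComponent 1 f = 0 ∧ homogeneousComponent 2 f ∈ Submodule.span R s := by
  induction hf using Algebra.adjoin_induction with
  | mem f hf =>
    obtain ⟨d, hd, hfd⟩ := hs f hf
    rw [homogeneousComponent_of_mem hfd, homogeneousComponent_of_mem hfd, if_neg hd.symm]
    split_ifs
    · exact ⟨rfl, Submodule.subset_span hf⟩
    · exact ⟨rfl, Submodule.zero_mem _⟩
  | algebraMap r =>
    have hr : (algebraMap R (MvPolynomial σ R) r).IsHomogeneous 0 :=
      MvPolynomial.isHomogeneous_C σ r
    simp only [homogeneousComponent_of_mem hr]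
    exact ⟨rfl, Submodule.zero_mem _⟩
  | add f g _ _ hf hg =>
    simp only [map_add, hf.1, hg.1, add_zero, true_and]
    exact Submodule.add_mem _ hf.2 hg.2
  | mul f g _ _ hf hg =>
    have h1 : homogeneousComponent 1 (f * g) = 0 := by
      simp [homogeneousComponent_mul, Finset.Nat.antidiagonal_succ, hf.1, hg.1]
    have h2 : homogeneousComponent 2 (f * g) = MvPolynomial.coeff 0 f • homogeneousComponent 2 g +
        MvPolynomial.coeff 0 g • homogeneousComponent 2 f := by
      simp [homogeneousComponent_mul, Finset.Nat.antidiagonal_succ, hf.1, hg.1,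
        MvPolynomial.homogeneousComponent_zero, MvPolynomial.smul_eq_C_mul, mul_comm]
    rw [h1, h2]
    exact ⟨rfl, Submodule.add_mem _ (Submodule.smul_mem _ _ hg.2) (Submodule.smul_mem _ _ hf.2)⟩

end QuadraticPart

section Extrema

lemma not_linearIndependent_of_isLocalExtrOn {ι F : Type*} [Finite ι] [NormedAddCommGroup F]
    [NormedSpace ℝ F] [CompleteSpace F] {φ : ι → F → ℝ} {φ' : ι → StrongDual ℝ F} {x₀ : F}
    (hφ : ∀ i, HasStrictFDerivAt (φ i) (φ' i) x₀) (j : ι)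
    (hextr : IsLocalExtrOn (φ j) {x | ∀ i ≠ j, φ i x = φ i x₀} x₀) :
    ¬ LinearIndependent ℝ φ' := by
  classical
  have hextr' : IsLocalExtrOn (φ j) {x | ∀ i : {i // i ≠ j}, φ i x = φ i x₀} x₀ := by
    simpa only [Subtype.forall] using hextr
  have hdep := hextr'.linear_dependent_of_hasStrictFDerivAt (fun i => hφ i) (hφ j)
  refine fun hind => hdep ?_
  convert hind.comp (Equiv.optionSubtypeNe j) (Equiv.injective _) using 1
  ext (_ | i) <;> rfl

lemma exists_isExtrOn_of_norm_sq_eq_sum {ι F : Type*} [Fintype ι] [NormedAddCommGroup F]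
    [ProperSpace F] {φ : ι → F → ℝ} (hφ : ∀ i, Continuous (φ i)) {a : ι → ℝ}
    (ha : ∀ x, ‖x‖ ^ 2 = ∑ i, a i * φ i x) (j : ι) (p : F) :
    ∃ x ∈ {y | ∀ i ≠ j, φ i y = φ i p}, IsExtrOn (φ j) {y | ∀ i ≠ j, φ i y = φ i p} x := by
  classical
  set Y : Set F := {y | ∀ i ≠ j, φ i y = φ i p} with hY
  have hp : p ∈ Y := fun _ _ => rfl
  have hclosed : IsClosed Y := by
    simp only [hY, Set.ofPred_forall]
    exact isClosed_biInter fun i _ => isClosed_eq (hφ i) continuous_const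
  obtain ⟨b, hb⟩ : ∃ b, ∀ y ∈ Y, ‖y‖ ^ 2 = a j * φ j y + b :=
    ⟨∑ i ∈ Finset.univ.erase j, a i * φ i p, fun y hy => by
      rw [ha, ← Finset.add_sum_erase _ _ (Finset.mem_univ j)]
      exact congrArg _ (Finset.sum_congr rfl fun i hi => by rw [hy i (Finset.ne_of_mem_erase hi)])⟩
  by_cases haj : a j = 0
  · have hbound : Y ⊆ Metric.closedBall 0 √b := fun y hy => by
      rw [mem_closedBall_zero_iff]
      exact Real.le_sqrt_of_sq_le (by rw [hb y hy, haj, zero_mul, zero_add])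
    obtain ⟨x, hx, hmax⟩ := (Metric.isCompact_of_isClosed_isBounded hclosed
      (Metric.isBounded_closedBall.subset hbound)).exists_isMaxOn ⟨p, hp⟩ (hφ j).continuousOn
    exact ⟨x, hx, hmax.isExtr⟩
  · obtain ⟨x, hx, hdist⟩ := hclosed.exists_infDist_eq_dist ⟨p, hp⟩ 0
    have hle : ∀ y ∈ Y, a j * φ j x ≤ a j * φ j y := fun y hy => by
      have hxy : ‖x‖ ≤ ‖y‖ := by
        rw [← dist_zero_left, ← dist_zero_left, ← hdist]
        exact Metric.infDist_le_dist_of_mem hy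
      have hsq : ‖x‖ ^ 2 ≤ ‖y‖ ^ 2 := by gcongr
      rw [hb x hx, hb y hy] at hsq
      exact le_of_add_le_add_right hsq
    refine ⟨x, hx, ?_⟩
    rcases lt_or_gt_of_ne haj with h | h
    · exact Or.inr fun y hy => (mul_le_mul_left_of_neg h).1 (hle y hy)
    · exact Or.inl fun y hy => (mul_le_mul_iff_right₀ h).1 (hle y hy)

end Extrema

section FibersOfInvariants

variable {n : ℕ} {G : Subgroup (EuclideanSpace ℝ (Fin n) ≃ₗᵢ[ℝ] EuclideanSpace ℝ (Fin n))}

lemma exists_eq_innerPoly {f : MvPolynomial (Fin n) ℝ} (hf : f.IsHomogeneous 1) :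
    ∃ w, f = innerPoly w := by
  have hmem : f ∈ Submodule.span ℝ (Set.range MvPolynomial.X) :=
    (MvPolynomial.homogeneousSubmodule_one_eq_span_X (R := ℝ)).le hf
  obtain ⟨c, rfl⟩ := (Submodule.mem_span_range_iff_exists_fun ℝ).1 hmem
  exact ⟨WithLp.toLp 2 c, rfl⟩

lemma IsEssential.eq_zero_of_isHomogeneous_one (hess : IsEssential G)
    {f : MvPolynomial (Fin n) ℝ} (hf : f ∈ invariants G) (h1 : f.IsHomogeneous 1) : f = 0 := by
  obtain ⟨w, rfl⟩ := exists_eq_innerPoly h1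
  have hfix : ∀ g ∈ G, g w = w := fun g hg => ext_inner_right ℝ fun x => by
    have hx : ⟪w, g⁻¹ x⟫ = ⟪w, x⟫ := by simpa only [evalAt_innerPoly] using hf g hg x
    rw [← hx, ← g.inner_map_map w]
    exact congrArg _ (g.apply_symm_apply x).symm
  have hbot : ℝ ∙ w = ⊥ := hess _ fun g hg u hu => by
    obtain ⟨r, rfl⟩ := Submodule.mem_span_singleton.1 hu
    rw [map_smul, hfix g hg]
  simp [Submodule.span_singleton_eq_bot.1 hbot, innerPoly]

lemma sqDistPoly_zero_mem_invariants : sqDistPoly 0 ∈ invariants G := fun g _ x => by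
  rw [evalAt_sqDistPoly, evalAt_sqDistPoly, sub_zero, sub_zero, LinearIsometryEquiv.norm_map]

lemma isHomogeneous_sqDistPoly_zero :
    (sqDistPoly (0 : EuclideanSpace ℝ (Fin n))).IsHomogeneous 2 := by
  simpa [sqDistPoly] using
    MvPolynomial.IsHomogeneous.sum _ _ 2 fun i _ => (MvPolynomial.isHomogeneous_X ℝ i).pow 2

lemma IsBasicInvariants.mem_invariants {π : Fin n → MvPolynomial (Fin n) ℝ}
    (hπ : IsBasicInvariants G π) (i : Fin n) : π i ∈ invariants G :=
  hπ.generate ▸ Algebra.subset_adjoin (Set.mem_range_self i)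

lemma IsEssential.exists_norm_sq_eq_sum (hess : IsEssential G)
    {π : Fin n → MvPolynomial (Fin n) ℝ} (hπ : IsBasicInvariants G π) :
    ∃ a : Fin n → ℝ, ∀ x : EuclideanSpace ℝ (Fin n), ‖x‖ ^ 2 = ∑ i, a i * evalAt x (π i) := by
  have hdeg : ∀ f ∈ Set.range π, ∃ d ≠ 1, f.IsHomogeneous d := by
    rintro _ ⟨i, rfl⟩
    obtain ⟨d, hd⟩ := hπ.homogeneous i
    rcases eq_or_ne d 1 with rfl | hd1
    · exact ⟨0, zero_ne_one,
        hess.eq_zero_of_isHomogeneous_one (hπ.mem_invariants i) hd ▸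
          MvPolynomial.isHomogeneous_zero _ _ _⟩
    · exact ⟨d, hd1, hd⟩
  have hspan := (homogeneousComponent_one_eq_zero_and_two_mem_span hdeg
    (hπ.generate ▸ sqDistPoly_zero_mem_invariants)).2
  rw [homogeneousComponent_of_mem isHomogeneous_sqDistPoly_zero, if_pos rfl,
    Submodule.mem_span_range_iff_exists_fun] at hspan
  obtain ⟨a, ha⟩ := hspan
  refine ⟨a, fun x => ?_⟩
  have h := congrArg (evalAt x) ha
  rw [evalAt_sum, evalAt_sqDistPoly, sub_zero] at h
  rw [← h]
  simp [evalAt]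

lemma isRegular_of_notMem_stratum {p : EuclideanSpace ℝ (Fin n)} (hp : p ∉ stratum G (n - 1)) :
    IsRegular G p := by
  rintro α ⟨hα1, hαG⟩ h
  have hα : α ≠ 0 := norm_ne_zero_iff.1 (hα1 ▸ one_ne_zero)
  have hker : (ℝ ∙ α)ᗮ =
      LinearMap.ker ((rootReflection α).toLinearEquiv.toLinearMap - LinearMap.id) := by
    ext x
    rw [LinearMap.mem_ker, LinearMap.sub_apply, sub_eq_zero]
    exact (Submodule.reflection_eq_self_iff x).symm
  refine hp ⟨(ℝ ∙ α)ᗮ, ⟨{(ℝ ∙ α)ᗮ}, ?_, sInf_singleton.symm⟩, ?_, ?_⟩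
  · exact Set.singleton_subset_iff.2 ⟨rootReflection α, hαG, ⟨α, hα, rfl⟩, hker⟩
  · have h1 := Submodule.finrank_add_finrank_orthogonal (ℝ ∙ α)
    rw [finrank_span_singleton hα, finrank_euclideanSpace_fin] at h1
    omega
  · exact Submodule.mem_orthogonal_singleton_iff_inner_right.2 h

lemma IsReflectionGroup.exists_mem_stratum (hG : IsReflectionGroup G) (hess : IsEssential G)
    {π : Fin n → MvPolynomial (Fin n) ℝ} (hπ : IsBasicInvariants G π) (j : Fin n)
    (p : EuclideanSpace ℝ (Fin n)) :
    ∃ x ∈ stratum G (n - 1), ∀ i ≠ j, evalAt x (π i) = evalAt p (π i) := by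
  have := hG.finite
  obtain ⟨a, ha⟩ := hess.exists_norm_sq_eq_sum hπ
  obtain ⟨x, hx, hextr⟩ :=
    exists_isExtrOn_of_norm_sq_eq_sum (fun i => continuous_evalAt (π i)) ha j p
  refine ⟨x, by_contra fun hxs => ?_, hx⟩
  have hstab : ∀ g ∈ G, g x = x → g = 1 := fun g hg hgx =>
    (isRegular_of_notMem_stratum hxs).eq_one_of_apply_eq_self hG.generated.ge hg hgx
  have hfiber : {y | ∀ i ≠ j, evalAt y (π i) = evalAt p (π i)} =
      {y | ∀ i ≠ j, evalAt y (π i) = evalAt x (π i)} :=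
    Set.ext fun y => forall₂_congr fun i hi => by rw [hx i hi]
  rw [hfiber] at hextr
  exact not_linearIndependent_of_isLocalExtrOn (fun i => hasStrictFDerivAt_evalAt (π i) x) j
    hextr.localize (linearIndependent_differential hπ.generate hstab)

end FibersOfInvariants

end ReflectionGroups

theorem theorem1p3 {n m : ℕ}
    (G : Subgroup (EuclideanSpace ℝ (Fin n) ≃ₗᵢ[ℝ] EuclideanSpace ℝ (Fin n)))
    (hG : ReflectionGroups.IsReflectionGroup G) (hess : ReflectionGroups.IsEssential G)
    (π : Fin n → MvPolynomial (Fin n) ℝ) (hπ : ReflectionGroups.IsBasicInvariants G π)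
    (f : Fin m → MvPolynomial (Fin n) ℝ)
    (hX : (ReflectionGroups.realVariety f).Nonempty)
    (j : Fin n) (hf : ∀ k, f k ∈ Algebra.adjoin ℝ (π '' {i | i ≠ j})) :
    (ReflectionGroups.realVariety f ∩ ReflectionGroups.stratum G (n - 1)).Nonempty := by
  obtain ⟨p, hp⟩ := hX
  obtain ⟨x, hxs, hx⟩ := hG.exists_mem_stratum hess hπ j p
  have hfx : ∀ k, ReflectionGroups.evalAt x (f k) = ReflectionGroups.evalAt p (f k) := fun k =>
    ReflectionGroups.evalAt_eq_of_mem_adjoin (Set.forall_mem_image.2 hx) (hf k)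
  exact ⟨x, fun k => (hfx k).trans (hp k), hxs⟩
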